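/- For a complex number $z$ let $(z\mid\alpha)_0=1$ and $(z\mid\alpha)_n=z(z-\alpha)\cdots(z-(n-1)\alpha)$ for $n\ge1$, and let $(1+\alpha t)^{z/\alpha}$ denote the formal power series $\sum_{n\ge0}(z\mid\alpha)_n\,t^n/n!$, which for $\alpha=0$ is $e^{zt}$. For $\beta\neq0$ the generalized Stirling numbers $S(n,k;\alpha,\beta,r)$ are defined by $$\left(\frac{(1+\alpha t)^{\beta/\alpha}-1}{\beta}\right)^{k}(1+\alpha t)^{r/\alpha}=k!\sum_{n\ge0}S(n,k;\alpha,\beta,r)\frac{t^n}{n!},$$ and the generalized geometric polynomials by $$w_n(x;\alpha,\beta,r)=\sum_{k=0}^{n}S(n,k;\alpha,\beta,r)\,\beta^k\,k!\,x^k .$$ Let $\zeta(s,q)=\sum_{k\ge0}(k+q)^{-s}$ be the Hurwitz zeta function, for $\operatorname{Re}s>1$ and complex $q\notin\{0,-1,-2,\dots\}$. All complex powers with complex exponent take their principal values. **Proposition.** Let $n\ge0$ be an integer, $x>0$ real, $\beta,r\in\mathbb C$ with $\operatorname{Re}\beta>0$ and $\operatorname{Re}r>0$, and let $a>n+1$ be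 real. Then the series defining $\zeta(t-n,r/\beta)$ converges absolutely for every $t$ with $\operatorname{Re}t=a$, the integral below converges absolutely, and $$\frac{e^{-rx}}{1-e^{-\beta x}}\;w_n\!\left(\frac{e^{-\beta x}}{1-e^{-\beta x}};0,\beta,r\right)=\frac{\beta^n}{2\pi i}\int_{a-i\infty}^{a+i\infty}(\beta x)^{-t}\,\zeta\!\left(t-n,\frac r\beta\right)\Gamma(t)\,dt .$$ -/

import Mathlib

open Complex MeasureTheory

noncomputable section

/-- The generalized factorial `(z ∣ α)_n = z (z - α) ⋯ (z - (n - 1) α)` with increment `α`. -/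
def genFactorial (z α : ℂ) (n : ℕ) : ℂ :=
  ∏ j ∈ Finset.range n, (z - (j : ℂ) * α)

/-- The formal power series `(1 + α t)^(z / α) = ∑ (z ∣ α)_n t^n / n!`; for `α = 0` this is its
limit `exp (z t)`. -/
def binomialSeriesPow (α z : ℂ) : PowerSeries ℂ :=
  PowerSeries.mk fun n => genFactorial z α n / (n.factorial : ℂ)

/-- The generalized Stirling numbers `S(n, k; α, β, r)` of Hsu and Shiue, for `β ≠ 0`, given by
`(((1 + α t)^(β / α) - 1) / β)^k (1 + α t)^(r / α) = k! ∑ S(n, k; α, β, r) t^n / n!`. -/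
def genStirling (n k : ℕ) (α β r : ℂ) : ℂ :=
  (n.factorial : ℂ) / (k.factorial : ℂ) *
    PowerSeries.coeff n
      ((PowerSeries.C β⁻¹ * (binomialSeriesPow α β - 1)) ^ k * binomialSeriesPow α r)

/-- The generalized geometric polynomials
`w_n(x; α, β, r) = ∑_{k ≤ n} S(n, k; α, β, r) β^k k! x^k`. -/
def genGeometric (n : ℕ) (x α β r : ℂ) : ℂ :=
  ∑ k ∈ Finset.range (n + 1), genStirling n k α β r * β ^ k * (k.factorial : ℂ) * x ^ k

/-- The Hurwitz zeta function `ζ(s, q) = ∑_{k ≥ 0} (k + q)^(-s)` (principal powers) on the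
half-plane `Re s > 1`, for complex `q` different from `0, -1, -2, …`. -/
def hurwitzZetaFun (s q : ℂ) : ℂ :=
  ∑' k : ℕ, ((k : ℂ) + q) ^ (-s)

/-- The line integral of `F` along the upward vertical line `Re t = a`: with `t = a + i y`,
`dt = i dy`. -/
def verticalIntegral (F : ℂ → ℂ) (a : ℝ) : ℂ :=
  I * ∫ y : ℝ, F ((a : ℂ) + (y : ℂ) * I)

end

/-! For `α = 0` the Stirling generating function is `(e^(βt) - 1)^k e^(rt)`. Expanding `e^(jβt) =
((e^(βt) - 1) + 1)^j` gives `(jβ + r)^n` as a binomial sum of Stirling numbers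
(`sum_choose_mul_genStirling`). Summing against `y^j` with `y = e^(-βx)` turns the left-hand side
into `∑ (jβ + r)^n e^(-(jβ + r)x)`.

Each exponential `e^(-w)`, `w = (jβ + r)x`, is a Cahen-Mellin integral of `w^(-t) Γ(t)`
(`integral_cpow_neg_mul_Gamma`). Sum and integral may be exchanged because all `w` lie in one sector
`|arg w| ≤ θ < π/2`, so `|w^(-t)|` grows at most like `e^(θ|Im t|)`, while `Γ` decays like `e^(-φ|Im
t|)` for any `φ < π/2`. The condition `a > n + 1` makes the resulting majorant summable. -/

/-! ### Stirling numbers and geometric polynomials at `α = 0`. -/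

theorem binomialSeriesPow_zero_left (z : ℂ) :
    binomialSeriesPow 0 z = PowerSeries.rescale z (PowerSeries.exp ℂ) := by
  ext n
  simp [binomialSeriesPow, genFactorial, PowerSeries.coeff_rescale, PowerSeries.coeff_exp,
    div_eq_mul_inv]

theorem genStirling_zero_mul (n k : ℕ) {β : ℂ} (r : ℂ) (hβ : β ≠ 0) :
    genStirling n k 0 β r * β ^ k * (k.factorial : ℂ) =
      (n.factorial : ℂ) * PowerSeries.coeff n
        ((PowerSeries.rescale β (PowerSeries.exp ℂ) - 1) ^ k *
          PowerSeries.rescale r (PowerSeries.exp ℂ)) := by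
  have hk : (k.factorial : ℂ) ≠ 0 := by exact_mod_cast k.factorial_ne_zero
  rw [genStirling, binomialSeriesPow_zero_left, binomialSeriesPow_zero_left, mul_pow, mul_assoc,
    ← map_pow, mul_assoc (PowerSeries.C _), PowerSeries.coeff_C_mul, inv_pow]
  field_simp

/-- `e^(βt) - 1` has no constant term, so its `k`-th power is divisible by `X^k`. -/
theorem coeff_exp_sub_one_pow_mul_eq_zero {n k : ℕ} (hnk : n < k) (β : ℂ) (f : PowerSeries ℂ) :
    PowerSeries.coeff n ((PowerSeries.rescale β (PowerSeries.exp ℂ) - 1) ^ k * f) = 0 := by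
  have h : PowerSeries.X ∣ PowerSeries.rescale β (PowerSeries.exp ℂ) - 1 := by
    rw [PowerSeries.X_dvd_iff, map_sub, ← PowerSeries.coeff_zero_eq_constantCoeff_apply,
      PowerSeries.coeff_rescale]
    simp
  exact PowerSeries.X_pow_dvd_iff.1 ((pow_dvd_pow_of_dvd h k).trans (dvd_mul_right _ f)) n hnk

theorem rescale_exp_pow (β : ℂ) (j : ℕ) :
    PowerSeries.rescale β (PowerSeries.exp ℂ) ^ j =
      PowerSeries.rescale (j * β) (PowerSeries.exp ℂ) := by
  rw [← map_pow, PowerSeries.exp_pow_eq_rescale_exp, PowerSeries.rescale_rescale]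

/-- The power `(j β + r) ^ n` in terms of the generalized Stirling numbers with `α = 0`. -/
theorem sum_choose_mul_genStirling (n j : ℕ) {β : ℂ} (r : ℂ) (hβ : β ≠ 0) :
    ∑ k ∈ Finset.range (n + 1),
      (j.choose k : ℂ) * (genStirling n k 0 β r * β ^ k * (k.factorial : ℂ)) =
        ((j : ℂ) * β + r) ^ n := by
  set D : ℕ → ℂ := fun k => (j.choose k : ℂ) * ((n.factorial : ℂ) * PowerSeries.coeff n
    ((PowerSeries.rescale β (PowerSeries.exp ℂ) - 1) ^ k *
      PowerSeries.rescale r (PowerSeries.exp ℂ))) with hD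
  have hfac : (n.factorial : ℂ) ≠ 0 := by exact_mod_cast n.factorial_ne_zero
  have hpow : ∑ k ∈ Finset.range (j + 1), D k = ((j : ℂ) * β + r) ^ n := by
    have h1 : PowerSeries.coeff n (PowerSeries.rescale β (PowerSeries.exp ℂ) ^ j *
        PowerSeries.rescale r (PowerSeries.exp ℂ)) =
          ((j : ℂ) * β + r) ^ n / (n.factorial : ℂ) := by
      rw [rescale_exp_pow, PowerSeries.exp_mul_exp_eq_exp_add]
      simp [PowerSeries.coeff_rescale, PowerSeries.coeff_exp, div_eq_mul_inv]
    have h2 : PowerSeries.rescale β (PowerSeries.exp ℂ) ^ j =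
        ∑ k ∈ Finset.range (j + 1), PowerSeries.C (j.choose k : ℂ) *
          (PowerSeries.rescale β (PowerSeries.exp ℂ) - 1) ^ k := by
      conv_lhs => rw [← sub_add_cancel (PowerSeries.rescale β (PowerSeries.exp ℂ)) 1]
      rw [add_pow]
      refine Finset.sum_congr rfl fun k _ => ?_
      simp [mul_comm]
    rw [h2, Finset.sum_mul, map_sum] at h1
    simp only [mul_assoc, PowerSeries.coeff_C_mul] at h1
    rw [eq_div_iff hfac, Finset.sum_mul] at h1
    rw [← h1]
    refine Finset.sum_congr rfl fun k _ => ?_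
    simp only [hD]; ring
  -- `D k` vanishes for `k > n` (order of the series) and for `k > j` (binomial coefficient), so
  -- both ranges extend to a common one.
  have hn : ∑ k ∈ Finset.range (n + 1), D k = ∑ k ∈ Finset.range (n + j + 1), D k := by
    refine Finset.sum_subset (Finset.range_mono (by omega)) fun k _ hk => ?_
    rw [Finset.mem_range] at hk
    simp only [hD]
    rw [coeff_exp_sub_one_pow_mul_eq_zero (by omega)]; simp
  have hj : ∑ k ∈ Finset.range (j + 1), D k = ∑ k ∈ Finset.range (n + j + 1), D k := by
    refine Finset.sum_subset (Finset.range_mono (by omega)) fun k _ hk => ?_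
    rw [Finset.mem_range] at hk
    simp only [hD]
    rw [Nat.choose_eq_zero_of_lt (by omega)]; simp
  simp only [genStirling_zero_mul n _ r hβ]
  exact hn.trans (hj.symm.trans hpow)

theorem hasSum_choose_mul_pow (k : ℕ) {y : ℂ} (hy : ‖y‖ < 1) :
    HasSum (fun j : ℕ => (j.choose k : ℂ) * y ^ j) (1 / (1 - y) * (y / (1 - y)) ^ k) := by
  have h := (hasSum_choose_mul_geometric_of_norm_lt_one k hy).mul_left (y ^ k)
  rw [← hasSum_nat_add_iff' k]
  have h0 : ∑ j ∈ Finset.range k, (j.choose k : ℂ) * y ^ j = 0 :=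
    Finset.sum_eq_zero fun j hj => by
      rw [Nat.choose_eq_zero_of_lt (Finset.mem_range.1 hj)]; simp
  rw [h0, sub_zero]
  convert! h using 1
  · funext j; ring
  · rw [pow_succ, div_pow, one_div, one_div, mul_inv]; ring

theorem hasSum_pow_mul_genGeometric (n : ℕ) {β y : ℂ} (r : ℂ) (hβ : β ≠ 0) (hy : ‖y‖ < 1) :
    HasSum (fun j : ℕ => ((j : ℂ) * β + r) ^ n * y ^ j)
      (1 / (1 - y) * genGeometric n (y / (1 - y)) 0 β r) := by
  have h := hasSum_sum (s := Finset.range (n + 1)) fun k _ =>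
    (hasSum_choose_mul_pow k hy).mul_left (genStirling n k 0 β r * β ^ k * (k.factorial : ℂ))
  convert! h using 1
  · funext j
    rw [← sum_choose_mul_genStirling n j r hβ, Finset.sum_mul]
    exact Finset.sum_congr rfl fun k _ => by ring
  · rw [genGeometric, Finset.mul_sum]
    exact Finset.sum_congr rfl fun k _ => by ring

/-! ### Mellin transform of exponentials with complex rate. -/

theorem norm_ofReal_cpow_mul_exp_neg {u : ℝ} (hu : 0 < u) (s z : ℂ) :
    ‖(u : ℂ) ^ s * cexp (-(z * u))‖ = u ^ s.re * Real.exp (-z.re * u) := by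
  rw [norm_mul, norm_cpow_eq_rpow_re_of_pos hu, norm_exp]
  simp

theorem integrableOn_rpow_mul_exp_neg {s b : ℝ} (hs : -1 < s) (hb : 0 < b) :
    IntegrableOn (fun u : ℝ => u ^ s * Real.exp (-b * u)) (Set.Ioi 0) := by
  simpa using integrableOn_rpow_mul_exp_neg_mul_rpow hs one_pos hb

theorem mellinConvergent_exp_neg_mul {s z : ℂ} (hs : 0 < s.re) (hz : 0 < z.re) :
    MellinConvergent (fun u : ℝ => cexp (-(z * u))) s := by
  refine Integrable.mono' (integrableOn_rpow_mul_exp_neg (s := s.re - 1) (by linarith) hz)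
    (by simp only [smul_eq_mul]; exact (by fun_prop : Measurable _).aestronglyMeasurable) ?_
  filter_upwards [ae_restrict_mem measurableSet_Ioi] with u hu
  rw [smul_eq_mul, norm_ofReal_cpow_mul_exp_neg hu]
  simp

theorem differentiableAt_mellin_exp_neg_mul {s z : ℂ} (hs : 0 < s.re) (hz : 0 < z.re) :
    DifferentiableAt ℂ (fun w : ℂ => mellin (fun u : ℝ => cexp (-(w * u))) s) z := by
  -- Halving `Re z` leaves a neighbourhood on which one integrable bound dominates every derivative.
  have hS : {w : ℂ | z.re / 2 < w.re} ∈ nhds z :=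
    (isOpen_lt continuous_const continuous_re).mem_nhds (by simp; linarith)
  refine (hasDerivAt_integral_of_dominated_loc_of_deriv_le hS
    (μ := volume.restrict (Set.Ioi 0))
    (F := fun w (u : ℝ) => (u : ℂ) ^ (s - 1) • cexp (-(w * u)))
    (F' := fun w (u : ℝ) => (u : ℂ) ^ (s - 1) * (cexp (-(w * u)) * -(u : ℂ)))
    (bound := fun u : ℝ => u ^ s.re * Real.exp (-(z.re / 2) * u)) ?_
    (mellinConvergent_exp_neg_mul hs hz) ?_ ?_ ?_ ?_).2.differentiableAt
  · refine Filter.Eventually.of_forall fun w => ?_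
    simp only [smul_eq_mul]
    exact (by fun_prop : Measurable _).aestronglyMeasurable
  · exact (by fun_prop : Measurable _).aestronglyMeasurable
  · filter_upwards [ae_restrict_mem measurableSet_Ioi] with u hu w hw
    have hu' : (0 : ℝ) < u := hu
    rw [← mul_assoc, norm_mul, norm_ofReal_cpow_mul_exp_neg hu, norm_neg, norm_real,
      Real.norm_of_nonneg hu'.le, mul_right_comm, ← Real.rpow_add_one hu'.ne']
    have : (s - 1).re + 1 = s.re := by simp
    rw [this]
    have hw' : z.re / 2 < w.re := hw
    gcongr
  · exact integrableOn_rpow_mul_exp_neg (by linarith) (by linarith)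
  · refine Filter.Eventually.of_forall fun u w _ => ?_
    simp only [smul_eq_mul]
    refine HasDerivAt.const_mul _ (HasDerivAt.cexp ?_)
    exact ((hasDerivAt_mul_const (u : ℂ)).neg : _)

/-- The Mellin transform of `u ↦ exp (-z u)` for `z` in the right half-plane. -/
theorem mellin_exp_neg_mul {s z : ℂ} (hs : 0 < s.re) (hz : 0 < z.re) :
    mellin (fun u : ℝ => cexp (-(z * u))) s = z ^ (-s) * Gamma s := by
  have hopen : IsOpen {w : ℂ | 0 < w.re} := isOpen_lt continuous_const continuous_re
  have hf : AnalyticOnNhd ℂ (fun w : ℂ => mellin (fun u : ℝ => cexp (-(w * u))) s)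
      {w : ℂ | 0 < w.re} := DifferentiableOn.analyticOnNhd
    (fun w hw => (differentiableAt_mellin_exp_neg_mul hs hw).differentiableWithinAt) hopen
  have hg : AnalyticOnNhd ℂ (fun w : ℂ => w ^ (-s) * Gamma s) {w : ℂ | 0 < w.re} :=
    DifferentiableOn.analyticOnNhd (fun w hw => ((differentiableAt_id.cpow_const
      (Or.inl hw)).mul_const _).differentiableWithinAt) hopen
  -- Identity theorem: both sides are analytic in the half-plane and agree at the real points `1 +
  -- 1/(m + 1)`, which accumulate at `1`.
  refine hf.eqOn_of_preconnected_of_frequently_eq (z₀ := 1) hg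
    (convex_halfSpace_re_gt 0).isPreconnected (by simp) ?_ hz
  have hreal : ∀ b : ℝ, 0 < b → mellin (fun u : ℝ => cexp (-((b : ℂ) * u))) s =
      (b : ℂ) ^ (-s) * Gamma s := fun b hb => by
    have h := integral_cpow_mul_exp_neg_mul_Ioi hs hb
    rw [one_div, inv_cpow_ofReal_nonneg hb.le, ← cpow_neg] at h
    simpa [mellin] using h
  have htend : Filter.Tendsto (fun m : ℕ => ((1 + 1 / ((m : ℝ) + 1) : ℝ) : ℂ)) Filter.atTop
      (nhdsWithin 1 {1}ᶜ) := by
    refine tendsto_nhdsWithin_iff.2 ⟨?_, Filter.Eventually.of_forall fun m => ?_⟩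
    · have h := (tendsto_one_div_add_atTop_nhds_zero_nat (𝕜 := ℝ)).const_add 1
      have h2 := (continuous_ofReal.tendsto _).comp h
      simpa [Function.comp_def] using h2
    · have : (0 : ℝ) < 1 / ((m : ℝ) + 1) := by positivity
      simp only [Set.mem_compl_iff, Set.mem_singleton_iff, ← ofReal_one, ofReal_inj]
      linarith
  exact htend.frequently (Filter.Frequently.of_forall fun m => hreal _ (by positivity))

/-! ### Decay of `Γ` against powers of points in a sector. -/

theorem norm_cpow_neg_line {w : ℂ} (hw : w ≠ 0) (t : ℂ) :
    ‖w ^ (-t)‖ = ‖w‖ ^ (-t.re) * Real.exp (arg w * t.im) := by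
  rw [norm_cpow_of_ne_zero hw, div_eq_mul_inv, ← Real.exp_neg]
  simp

/-- `Γ` decays like `exp (-φ |Im t|)` on vertical lines in the right half-plane, for each
`φ < π / 2`. -/
theorem norm_Gamma_le_mul_exp {a φ : ℝ} (ha : 0 < a) (hφ : 0 ≤ φ) (hφ' : φ < Real.pi / 2) :
    ∃ C : ℝ, 0 ≤ C ∧ ∀ t : ℂ, t.re = a → ‖Gamma t‖ ≤ C * Real.exp (-(φ * |t.im|)) := by
  have hcos : 0 < Real.cos φ := Real.cos_pos_of_mem_Ioo ⟨by linarith [Real.pi_pos], hφ'⟩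
  refine ⟨∫ u in Set.Ioi (0 : ℝ), u ^ (a - 1) * Real.exp (-Real.cos φ * u),
    setIntegral_nonneg measurableSet_Ioi fun u hu => by
      have : (0 : ℝ) < u := hu
      positivity, fun t ht => ?_⟩
  -- Taking `z = e^(iψ)` in the Mellin formula produces the factor `e^(ψ Im t)`; the sign of `ψ` is
  -- later matched to that of `Im t`.
  have key : ∀ ψ : ℝ, |ψ| = φ → ‖Gamma t‖ * Real.exp (ψ * t.im) ≤
      ∫ u in Set.Ioi (0 : ℝ), u ^ (a - 1) * Real.exp (-Real.cos φ * u) := fun ψ hψ => by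
    have hψ2 : |ψ| < Real.pi / 2 := hψ ▸ hφ'
    have hre : (cexp (ψ * I)).re = Real.cos φ := by
      rw [exp_ofReal_mul_I_re, ← hψ, Real.cos_abs]
    have harg : arg (cexp (ψ * I)) = ψ := by
      rw [exp_mul_I]
      exact arg_cos_add_sin_mul_I ⟨by linarith [Real.pi_pos, (abs_lt.1 hψ2).1],
        by linarith [Real.pi_pos, (abs_lt.1 hψ2).2]⟩
    have h := mellin_exp_neg_mul (s := t) (z := cexp (ψ * I)) (ht ▸ ha) (hre ▸ hcos)
    have h2 : ‖mellin (fun u : ℝ => cexp (-(cexp (ψ * I) * u))) t‖ =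
        ‖Gamma t‖ * Real.exp (ψ * t.im) := by
      rw [h, norm_mul, norm_cpow_neg_line (exp_ne_zero _), harg, norm_exp_ofReal_mul_I]
      simp [mul_comm]
    rw [← h2]
    refine (norm_integral_le_integral_norm _).trans_eq
      (setIntegral_congr_fun measurableSet_Ioi fun u hu => ?_)
    simp only [smul_eq_mul]
    rw [norm_ofReal_cpow_mul_exp_neg hu, hre]
    simp [ht]
  rw [Real.exp_neg, ← div_eq_mul_inv, le_div_iff₀ (Real.exp_pos _)]
  rcases le_total 0 t.im with h | h
  · simpa [abs_of_nonneg h] using key φ (abs_of_nonneg hφ)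
  · simpa [abs_of_nonpos h] using key (-φ) (by rw [abs_neg, abs_of_nonneg hφ])

/-- The cone `|Im w| ≤ M Re w` is closed under addition and contains `b` and `r` for `M` the larger
of their slopes. -/
theorem exists_abs_arg_natCast_mul_add_le {b r : ℂ} (hb : 0 < b.re) (hr : 0 < r.re) :
    ∃ θ : ℝ, 0 ≤ θ ∧ θ < Real.pi / 2 ∧ ∀ k : ℕ, |arg ((k : ℂ) * b + r)| ≤ θ := by
  set M : ℝ := max (|b.im| / b.re) (|r.im| / r.re) with hM
  have hM0 : 0 ≤ M := le_max_of_le_left (by positivity)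
  refine ⟨Real.arctan M, Real.arctan_nonneg.2 hM0, Real.arctan_lt_pi_div_two M, fun k => ?_⟩
  have hre : 0 < ((k : ℂ) * b + r).re := by simp; positivity
  have hlt := abs_lt.1 (abs_arg_lt_pi_div_two_iff.2 (Or.inl hre))
  have hb' : |b.im| ≤ M * b.re := (div_le_iff₀ hb).1 (le_max_left _ _)
  have hr' : |r.im| ≤ M * r.re := (div_le_iff₀ hr).1 (le_max_right _ _)
  have him : |((k : ℂ) * b + r).im| ≤ M * ((k : ℂ) * b + r).re := by
    have h1 : ((k : ℂ) * b + r).im = k * b.im + r.im := by simp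
    have h2 : ((k : ℂ) * b + r).re = k * b.re + r.re := by simp
    rw [h1, h2]
    calc |(k : ℝ) * b.im + r.im| ≤ |(k : ℝ) * b.im| + |r.im| := abs_add_le _ _
      _ = k * |b.im| + |r.im| := by rw [abs_mul, Nat.abs_cast]
      _ ≤ k * (M * b.re) + M * r.re := by gcongr
      _ = M * (k * b.re + r.re) := by ring
  rw [← Real.arctan_tan hlt.1 hlt.2, tan_arg]
  rw [← div_le_iff₀ hre] at him
  have hquot := abs_le.1 ((abs_div _ _).trans_le ((by rw [abs_of_pos hre]; exact him) :
    |((k : ℂ) * b + r).im| / |((k : ℂ) * b + r).re| ≤ M))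
  rw [abs_le, ← Real.arctan_neg]
  exact ⟨Real.arctan_strictMono.monotone hquot.1, Real.arctan_strictMono.monotone hquot.2⟩

theorem summable_norm_natCast_mul_add_rpow_neg {b r : ℂ} (hb : 0 < b.re) (hr : 0 < r.re) {s : ℝ}
    (hs : 1 < s) : Summable fun k : ℕ => ‖(k : ℂ) * b + r‖ ^ (-s) := by
  have h := ((Real.summable_one_div_nat_add_rpow (r.re / b.re) s).2 hs).mul_left (b.re ^ (-s))
  refine h.of_nonneg_of_le (fun k => by positivity) fun k => ?_
  have hpos : 0 < (k : ℝ) + r.re / b.re := by positivity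
  rw [abs_of_pos hpos, one_div, ← Real.rpow_neg hpos.le, ← Real.mul_rpow hb.le hpos.le]
  refine Real.rpow_le_rpow_of_nonpos (by positivity) ?_ (by linarith)
  calc b.re * (k + r.re / b.re) = ((k : ℂ) * b + r).re := by simp; field_simp
    _ ≤ ‖(k : ℂ) * b + r‖ := re_le_norm _

theorem log_div_of_re_pos {w b : ℂ} (hw : 0 < w.re) (hb : 0 < b.re) :
    log (w / b) = log w - log b := by
  have hw0 : w ≠ 0 := fun h => by simp [h] at hw
  have hb0 : b ≠ 0 := fun h => by simp [h] at hb
  have h1 := abs_lt.1 (abs_arg_lt_pi_div_two_iff.2 (Or.inl hw))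
  have h2 := abs_lt.1 (abs_arg_lt_pi_div_two_iff.2 (Or.inl hb))
  have hpi : arg b ≠ Real.pi := by linarith [Real.pi_pos]
  have harg : arg b⁻¹ = -arg b := by rw [arg_inv, if_neg hpi]
  rw [div_eq_mul_inv, (log_mul_eq_add_log_iff hw0 (inv_ne_zero hb0)).2, log_inv _ hpi,
    sub_eq_add_neg]
  rw [harg]
  constructor <;> linarith

/-- Principal powers split here because `w` and `b` both lie in the right half-plane, where `log (w
/ b) = log w - log b`. -/
theorem cpow_mul_div_cpow {w b : ℂ} (hw : 0 < w.re) (hb : 0 < b.re) (n : ℕ) (t : ℂ) :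
    b ^ (-t) * (w / b) ^ (-(t - n)) = (w / b) ^ n * w ^ (-t) := by
  have hw0 : w ≠ 0 := fun h => by simp [h] at hw
  have hb0 : b ≠ 0 := fun h => by simp [h] at hb
  have hq : w / b ≠ 0 := div_ne_zero hw0 hb0
  rw [show -(t - n) = (n : ℂ) + -t by ring, cpow_add _ _ hq, cpow_natCast, mul_left_comm,
    cpow_def_of_ne_zero hq, cpow_def_of_ne_zero hb0, cpow_def_of_ne_zero hw0, ← Complex.exp_add,
    log_div_of_re_pos hw hb]
  ring_nf

/-! ### Integration along vertical lines. -/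

theorem integrable_exp_neg_mul_abs {δ : ℝ} (hδ : 0 < δ) :
    Integrable fun y : ℝ => Real.exp (-(δ * |y|)) := by
  have h : Integrable fun y : ℝ => Real.exp (-δ * |y|) := by
    rw [← integrableOn_univ, ← Set.Iic_union_Ioi (a := (0 : ℝ))]
    refine ((integrableOn_exp_mul_Iic hδ 0).congr_fun (fun y hy => ?_) measurableSet_Iic).union
      ((integrableOn_exp_mul_Ioi (neg_lt_zero.2 hδ) 0).congr_fun (fun y hy => ?_)
        measurableSet_Ioi)
    · simp [abs_of_nonpos (show y ≤ 0 from hy)]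
    · simp [abs_of_pos (show 0 < y from hy)]
  simpa using h

theorem continuous_Gamma_vertical {a : ℝ} (ha : 0 < a) :
    Continuous fun y : ℝ => Gamma ((a : ℂ) + y * I) := by
  refine continuous_iff_continuousAt.2 fun y => ?_
  have hd : DifferentiableAt ℂ Gamma ((a : ℂ) + y * I) :=
    differentiableAt_Gamma _ fun m h => by
      have h2 := congrArg re h
      simp at h2
      linarith [(Nat.cast_nonneg m : (0 : ℝ) ≤ m)]
  exact ContinuousAt.comp (f := fun y : ℝ => (a : ℂ) + y * I) hd.continuousAt (by fun_prop)

theorem continuous_cpow_neg_vertical {w : ℂ} (hw : w ≠ 0) (a : ℝ) :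
    Continuous fun y : ℝ => w ^ (-((a : ℂ) + y * I)) :=
  Continuous.const_cpow (by fun_prop) (Or.inl hw)

theorem norm_cpow_neg_mul_Gamma_le {w : ℂ} (hw : w ≠ 0) {a θ φ C : ℝ} (hθ : |arg w| ≤ θ)
    (hC : ∀ t : ℂ, t.re = a → ‖Gamma t‖ ≤ C * Real.exp (-(φ * |t.im|))) (y : ℝ) :
    ‖w ^ (-((a : ℂ) + y * I)) * Gamma ((a : ℂ) + y * I)‖ ≤
      ‖w‖ ^ (-a) * (C * Real.exp (-((φ - θ) * |y|))) := by
  have hG := hC ((a : ℂ) + y * I) (by simp)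
  have hle : arg w * y ≤ θ * |y| := (le_abs_self _).trans (by rw [abs_mul]; gcongr)
  rw [norm_mul, norm_cpow_neg_line hw]
  simp only [add_re, ofReal_re, mul_re, I_re, mul_zero, ofReal_im, I_im, mul_one, sub_self,
    add_zero, add_im, mul_im, zero_add] at hG ⊢
  calc ‖w‖ ^ (-a) * Real.exp (arg w * y) * ‖Gamma ((a : ℂ) + y * I)‖
      ≤ ‖w‖ ^ (-a) * Real.exp (θ * |y|) * (C * Real.exp (-(φ * |y|))) := by gcongr
    _ = ‖w‖ ^ (-a) * (C * (Real.exp (θ * |y|) * Real.exp (-(φ * |y|)))) := by ring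
    _ = _ := by rw [← Real.exp_add]; ring_nf

theorem integrable_cpow_neg_mul_Gamma {w : ℂ} (hw : 0 < w.re) {a : ℝ} (ha : 0 < a) :
    Integrable fun y : ℝ => w ^ (-((a : ℂ) + y * I)) * Gamma ((a : ℂ) + y * I) := by
  have hw0 : w ≠ 0 := fun h => by simp [h] at hw
  obtain ⟨φ, hφ1, hφ2⟩ := exists_between (abs_arg_lt_pi_div_two_iff.2 (Or.inl hw))
  obtain ⟨C, -, hC⟩ := norm_Gamma_le_mul_exp ha ((abs_nonneg _).trans hφ1.le) hφ2
  refine Integrable.mono'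
    (((integrable_exp_neg_mul_abs (sub_pos.2 hφ1)).const_mul C).const_mul (‖w‖ ^ (-a)))
    ((continuous_cpow_neg_vertical hw0 a).mul
      (continuous_Gamma_vertical ha)).aestronglyMeasurable
    (Filter.Eventually.of_forall fun y => norm_cpow_neg_mul_Gamma_le hw0 le_rfl hC y)

/-- The Cahen-Mellin integral. -/
theorem integral_cpow_neg_mul_Gamma {w : ℂ} (hw : 0 < w.re) {a : ℝ} (ha : 0 < a) :
    ∫ y : ℝ, w ^ (-((a : ℂ) + y * I)) * Gamma ((a : ℂ) + y * I) =
      2 * (Real.pi : ℂ) * cexp (-w) := by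
  have hM : ∀ y : ℝ, mellin (fun u : ℝ => cexp (-(w * u))) ((a : ℂ) + y * I) =
      w ^ (-((a : ℂ) + y * I)) * Gamma ((a : ℂ) + y * I) := fun y =>
    mellin_exp_neg_mul (by simpa using ha) hw
  -- Mellin inversion evaluated at `u = 1`, where the kernel `u^(-t)` is `1`.
  have h := mellinInv_mellin_eq a (fun u : ℝ => cexp (-(w * u))) one_pos
    (mellinConvergent_exp_neg_mul (by simpa using ha) hw)
    (by simpa only [VerticalIntegrable, hM] using integrable_cpow_neg_mul_Gamma hw ha)
    (by fun_prop)
  simp only [mellinInv, hM, ofReal_one, one_cpow, one_smul, mul_one] at h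
  have hpi : (Real.pi : ℂ) ≠ 0 := ofReal_ne_zero.2 Real.pi_ne_zero
  rw [← h, real_smul, ← mul_assoc]
  push_cast
  rw [mul_one_div_cancel (mul_ne_zero two_ne_zero hpi), one_mul]

/-- Termwise integration of a general Dirichlet series against `Γ` on a vertical line. -/
theorem hasSum_integral_tsum_mul_cpow_neg_mul_Gamma {w c : ℕ → ℂ} {a θ : ℝ} (ha : 0 < a)
    (hw : ∀ k, 0 < (w k).re) (hθ0 : 0 ≤ θ) (hθ : θ < Real.pi / 2) (harg : ∀ k, |arg (w k)| ≤ θ)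
    (hc : Summable fun k => ‖c k‖ * ‖w k‖ ^ (-a)) :
    (Integrable fun y : ℝ =>
      (∑' k, c k * w k ^ (-((a : ℂ) + y * I))) * Gamma ((a : ℂ) + y * I)) ∧
    HasSum (fun k => c k * (2 * (Real.pi : ℂ) * cexp (-w k)))
      (∫ y : ℝ, (∑' k, c k * w k ^ (-((a : ℂ) + y * I))) * Gamma ((a : ℂ) + y * I)) := by
  have hw0 : ∀ k, w k ≠ 0 := fun k h => by simpa [h] using hw k
  -- The gap `φ - θ > 0` is the net exponential decay rate, uniform in `k`.
  obtain ⟨φ, hφ1, hφ2⟩ := exists_between hθ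
  obtain ⟨C, hC0, hC⟩ := norm_Gamma_le_mul_exp ha (hθ0.trans hφ1.le) hφ2
  set E : ℝ → ℝ := fun y => C * Real.exp (-((φ - θ) * |y|)) with hE
  have hEint : Integrable E := (integrable_exp_neg_mul_abs (sub_pos.2 hφ1)).const_mul C
  have hEle : ∀ y, E y ≤ C := fun y => mul_le_of_le_one_right hC0 (Real.exp_le_one_iff.2
    (neg_nonpos.2 (mul_nonneg (sub_pos.2 hφ1).le (abs_nonneg y))))
  set F : ℕ → ℝ → ℂ := fun k y =>
    c k * w k ^ (-((a : ℂ) + y * I)) * Gamma ((a : ℂ) + y * I) with hF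
  have hFle : ∀ k y, ‖F k y‖ ≤ ‖c k‖ * ‖w k‖ ^ (-a) * E y := fun k y => by
    simp only [hF]
    rw [mul_assoc, norm_mul, mul_assoc]
    exact mul_le_mul_of_nonneg_left (norm_cpow_neg_mul_Gamma_le (hw0 k) (harg k) hC y)
      (norm_nonneg _)
  have hFcont : ∀ k, Continuous (F k) := fun k =>
    (continuous_const.mul (continuous_cpow_neg_vertical (hw0 k) a)).mul
      (continuous_Gamma_vertical ha)
  have hFsum : ∀ y, Summable fun k => F k y := fun y =>
    (hc.mul_right (E y)).of_norm_bounded fun k => hFle k y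
  have htsum : ∀ y : ℝ, (∑' k, c k * w k ^ (-((a : ℂ) + y * I))) * Gamma ((a : ℂ) + y * I) =
      ∑' k, F k y := fun y => tsum_mul_right.symm
  have hcont : Continuous fun y => ∑' k, F k y :=
    continuous_tsum hFcont (hc.mul_right C) fun k y => (hFle k y).trans
      (mul_le_mul_of_nonneg_left (hEle y) (by positivity))
  have hbound : Integrable fun y => ∑' k, ‖c k‖ * ‖w k‖ ^ (-a) * E y := by
    simpa only [tsum_mul_right] using hEint.const_mul (∑' k, ‖c k‖ * ‖w k‖ ^ (-a))
  simp only [htsum]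
  refine ⟨hbound.mono' hcont.aestronglyMeasurable (Filter.Eventually.of_forall fun y =>
    tsum_of_norm_bounded (hc.mul_right (E y)).hasSum fun k => hFle k y), ?_⟩
  have h := hasSum_integral_of_dominated_convergence (F := F)
    (fun k y => ‖c k‖ * ‖w k‖ ^ (-a) * E y) (fun k => (hFcont k).aestronglyMeasurable)
    (fun k => Filter.Eventually.of_forall (hFle k))
    (Filter.Eventually.of_forall fun y => hc.mul_right (E y)) hbound
    (Filter.Eventually.of_forall fun y => (hFsum y).hasSum)
  refine h.congr_fun fun k => ?_
  simp only [hF, mul_assoc]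
  rw [integral_const_mul, integral_cpow_neg_mul_Gamma (hw k) ha]
  ring

/-! ### The Hurwitz zeta series and the final identity. -/

theorem summable_norm_div_pow_mul_rpow_neg {b r : ℂ} (hb : 0 < b.re) (hr : 0 < r.re) {n : ℕ}
    {a : ℝ} (ha : (n : ℝ) + 1 < a) :
    Summable fun k : ℕ => ‖(((k : ℂ) * b + r) / b) ^ n‖ * ‖(k : ℂ) * b + r‖ ^ (-a) := by
  refine ((summable_norm_natCast_mul_add_rpow_neg hb hr
    (s := a - n) (by linarith)).mul_left (‖b‖ ^ n)⁻¹).congr fun k => ?_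
  have hw : 0 < ‖(k : ℂ) * b + r‖ := norm_pos_iff.2 fun h => by
    have h1 : 0 < ((k : ℂ) * b + r).re := by simp; positivity
    simp [h] at h1
  rw [norm_pow, norm_div, div_pow, show -(a - n) = (n : ℝ) + -a by ring, Real.rpow_add hw,
    Real.rpow_natCast]
  ring

theorem natCast_add_div_eq {b : ℂ} (hb : b ≠ 0) (r : ℂ) (k : ℕ) :
    (k : ℂ) + r / b = ((k : ℂ) * b + r) / b := by
  field_simp

theorem cpow_neg_mul_natCast_add_div_cpow {b r : ℂ} (hb : 0 < b.re) (hr : 0 < r.re) (n k : ℕ)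
    (t : ℂ) : b ^ (-t) * ((k : ℂ) + r / b) ^ (-(t - n)) =
      (((k : ℂ) * b + r) / b) ^ n * ((k : ℂ) * b + r) ^ (-t) := by
  have hb0 : b ≠ 0 := fun h => by simp [h] at hb
  rw [natCast_add_div_eq hb0]
  exact cpow_mul_div_cpow (by simp; positivity) hb n t

theorem summable_natCast_add_div_cpow {b r : ℂ} (hb : 0 < b.re) (hr : 0 < r.re) {n : ℕ} {a : ℝ}
    (ha : (n : ℝ) + 1 < a) {t : ℂ} (ht : t.re = a) :
    Summable fun k : ℕ => ((k : ℂ) + r / b) ^ (-(t - (n : ℂ))) := by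
  have hb0 : b ≠ 0 := fun h => by simp [h] at hb
  have hbt : b ^ (-t) ≠ 0 := by simp [cpow_eq_zero_iff, hb0]
  obtain ⟨θ, -, -, hθ⟩ := exists_abs_arg_natCast_mul_add_le hb hr
  rw [← summable_mul_left_iff hbt]
  simp only [cpow_neg_mul_natCast_add_div_cpow hb hr]
  refine ((summable_norm_div_pow_mul_rpow_neg hb hr ha).mul_right
    (Real.exp (θ * |t.im|))).of_norm_bounded fun k => ?_
  have hw : (k : ℂ) * b + r ≠ 0 := fun h => by
    have h1 : 0 < ((k : ℂ) * b + r).re := by simp; positivity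
    simp [h] at h1
  rw [norm_mul, norm_cpow_neg_line hw, ht, ← mul_assoc]
  refine mul_le_mul_of_nonneg_left (Real.exp_le_exp.2 ?_) (by positivity)
  calc arg ((k : ℂ) * b + r) * t.im ≤ |arg ((k : ℂ) * b + r)| * |t.im| := by
        rw [← abs_mul]; exact le_abs_self _
    _ ≤ θ * |t.im| := by gcongr; exact hθ k

theorem cpow_neg_mul_hurwitzZetaFun {b r : ℂ} (hb : 0 < b.re) (hr : 0 < r.re) (n : ℕ) (t : ℂ) :
    b ^ (-t) * hurwitzZetaFun (t - n) (r / b) =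
      ∑' k : ℕ, (((k : ℂ) * b + r) / b) ^ n * ((k : ℂ) * b + r) ^ (-t) := by
  rw [hurwitzZetaFun, ← tsum_mul_left]
  exact tsum_congr fun k => cpow_neg_mul_natCast_add_div_cpow hb hr n k t

theorem mainTheorem10 (n : ℕ) (β r : ℂ) (hβ : 0 < β.re) (hr : 0 < r.re)
    (x : ℝ) (hx : 0 < x) (a : ℝ) (ha : (n : ℝ) + 1 < a) :
    -- the series of the Hurwitz zeta function converges absolutely on the line of integration
    (∀ t : ℂ, t.re = a → Summable fun k : ℕ => ((k : ℂ) + r / β) ^ (-(t - (n : ℂ)))) ∧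
    -- the integral converges absolutely
    Complex.VerticalIntegrable
      (fun t : ℂ => (β * (x : ℂ)) ^ (-t) * hurwitzZetaFun (t - (n : ℂ)) (r / β) *
        Complex.Gamma t) a ∧
    Complex.exp (-r * (x : ℂ)) / (1 - Complex.exp (-β * (x : ℂ))) *
        genGeometric n
          (Complex.exp (-β * (x : ℂ)) / (1 - Complex.exp (-β * (x : ℂ)))) 0 β r =
      β ^ n / (2 * (Real.pi : ℂ) * Complex.I) *
        verticalIntegral
          (fun t : ℂ => (β * (x : ℂ)) ^ (-t) * hurwitzZetaFun (t - (n : ℂ)) (r / β) *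
            Complex.Gamma t) a := by

  have hB : 0 < (β * (x : ℂ)).re := by simp; positivity
  have hR : 0 < (r * (x : ℂ)).re := by simp; positivity
  have hβ0 : β ≠ 0 := fun h => by simp [h] at hβ
  have hx0 : (x : ℂ) ≠ 0 := ofReal_ne_zero.2 hx.ne'
  -- Scaling by `x` leaves the zeta parameter unchanged, so the previous lemmas apply with `βx` and
  -- `rx`.
  have hq : r / β = r * x / (β * x) := (mul_div_mul_right _ _ hx0).symm
  have ha0 : 0 < a := by linarith [(Nat.cast_nonneg n : (0 : ℝ) ≤ n)]
  obtain ⟨θ, hθ0, hθ, harg⟩ := exists_abs_arg_natCast_mul_add_le hB hR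
  obtain ⟨hint, hsum⟩ := hasSum_integral_tsum_mul_cpow_neg_mul_Gamma
    (w := fun k : ℕ => (k : ℂ) * (β * x) + r * x)
    (c := fun k : ℕ => (((k : ℂ) * (β * x) + r * x) / (β * x)) ^ n) ha0
    (fun k => by
      rw [add_re, ← ofReal_natCast, re_ofReal_mul]
      positivity) hθ0 hθ harg (summable_norm_div_pow_mul_rpow_neg hB hR ha)
  refine ⟨fun t ht => ?_, ?_, ?_⟩
  · rw [hq]
    exact summable_natCast_add_div_cpow hB hR ha ht
  · simpa only [VerticalIntegrable, hq, cpow_neg_mul_hurwitzZetaFun hB hR] using hint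
  · have hy : ‖cexp (-β * x)‖ < 1 := by
      rw [norm_exp, Real.exp_lt_one_iff]
      simp; positivity
    have hgeo := (hasSum_pow_mul_genGeometric n r hβ0 hy).mul_left (cexp (-r * x))
    have hpi : (Real.pi : ℂ) ≠ 0 := ofReal_ne_zero.2 Real.pi_ne_zero
    -- `β^n` clears the denominators of `((kβ + r)/β)^n`, and `2π` the Cahen-Mellin constant.
    have hsum' := hsum.mul_left (β ^ n / (2 * (Real.pi : ℂ)))
    have heq := hgeo.unique (hsum'.congr_fun fun k => ?_)
    · simp only [verticalIntegral, hq, cpow_neg_mul_hurwitzZetaFun hB hR]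
      have hI : β ^ n / (2 * (Real.pi : ℂ) * I) * I = β ^ n / (2 * (Real.pi : ℂ)) := by
        field_simp
      rw [← mul_assoc (β ^ n / _), hI, ← heq]
      ring
    · have h1 : ((k : ℂ) * (β * x) + r * x) / (β * x) = ((k : ℂ) * β + r) / β := by
        rw [← mul_assoc, ← add_mul, mul_div_mul_right _ _ hx0]
      have h2 : cexp (-((k : ℂ) * (β * x) + r * x)) = cexp (-r * x) * cexp (-β * x) ^ k := by
        rw [← Complex.exp_nat_mul, ← Complex.exp_add]
        ring_nf
      simp only [h1, h2, div_pow]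
      field_simp
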